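/- Let $T$ be an abelian group, $W$ a finite group and $\sigma : W \to \mathrm{Aut}(T)$ an action. Let $\pi : Z \to X$ be an étale Galois cover of schemes with group $W$ (that is, $W$ acts on $Z$ from the right and $\pi$ is a principal $W$-bundle), with $Z$ connected; for instance an étale Galois cover of smooth projective curves. Abstract groups are regarded as constant group schemes and, for a group $G$, a principal $G$-bundle $f : Y \to B$ is an étale surjective morphism with a right action of $G$ on $Y$ over $B$ such that $Y\times G \to Y\times_B Y$, $(y,g)\mapsto (y,yg)$, is an isomorphism; equivalently, $G$ acts freely on $Y$ with quotient $B$. For $w \in W$ and a principal $T$-bundle $E$ on $Z$ let $w.E = w^*E \times_w T$, where $w^*E$ is the pull-back of $E$ by $z \mapsto zw$ and $E\times_w T$ is the quotient of $E \times T$ by $(et,t')\sim(e,\sigma(w)(t)t')$. Let $p : E \to Z$ be a principal $T$-bundle that is $W$-invariant, i.e. $E \cong w.E$ as $T$-bundles on $Z$ for all $w\in W$. Let $$N = \mathcal{G}^\sigma(E) = \{(w,\gamma) : w \in W,\ \gamma : E \to w.E \text{ an isomorphism of } T\text{-bundles on } Z\}$$ be its Mumford group, with product $(w_1,\gamma_1)(w_2,\gamma_2)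 = (w_1w_2, w_1(\gamma_2)\circ\gamma_1)$. It contains $T$ as the pairs $(1,t)$, and $n=(w,\gamma)$ acts on $E$ from the right through the composite $\mu_n : E \xrightarrow{\gamma} w^*E\times_w T \to E\times_w T \to E$, the last map being $\overline{(e,t)} \mapsto e\,\sigma(w)^{-1}(t)$. Then $\pi\circ p : E \to X$, with the action $\mu$ of $N$, is a principal $N$-bundle on $X$. Moreover, the quotient $E\times^T N$ of $E\times N$ by the action $(e,n)\cdot t = (et,t^{-1}n)$ of $T$ exists. The action $(e,n')\cdot n = (\mu_n(e), n^{-1}n')$ of $N$ on $E \times N$ induces a unique action of $W$ on $E\times^T N$. The quotient $F_N$ of $E\times^T N$ by this action of $W$ exists. With the action of $N$ induced by $(e,n)\cdot m = (e,nm)$ and the projection to $X$ induced by $(e,n)\mapsto \pi(p(e))$, $F_N$ is a principal $N$-bundle on $X$, and the map $e \mapsto \overline{(e,1)}$ is an isomorphism $E \to F_N$ of principal $N$-bundles on $X$. -/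

import Mathlib

open CategoryTheory CategoryTheory.Limits AlgebraicGeometry

universe u

noncomputable section

namespace MumfordBundle

/-- A right action of an abstract group `G` on a scheme `Y`: on points `act g` is `y ↦ y · g`, so
that `y · (g h) = (y · g) · h`.  This is the same as a right action of the constant group scheme
attached to `G`. -/
@[ext]
structure RightAction (G : Type u) [Group G] (Y : Scheme.{u}) where
  act : G → (Y ⟶ Y)
  act_one : act 1 = 𝟙 Y
  act_mul : ∀ g h : G, act (g * h) = act g ≫ act h

/-- The right action `ρ` of `G` on `Y` makes `f : Y ⟶ B` a principal `G`-bundle (for the étale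
topology): `f` is étale, surjective and `G`-invariant, and
`Y × G ⟶ Y ×_B Y, (y, g) ↦ (y, y · g)` is an isomorphism.
Equivalently, `G` acts freely on `Y` and `f` is the quotient of `Y` by `G`. -/
structure IsPrincipalBundle {G : Type u} [Group G] {Y B : Scheme.{u}}
    (ρ : RightAction G Y) (f : Y ⟶ B) : Prop where
  etale : Etale f
  surjective : Surjective f
  act_comp : ∀ g : G, ρ.act g ≫ f = f
  isIso_shear : IsIso (Sigma.desc (fun g : G =>
    pullback.lift (𝟙 Y) (ρ.act g) ((Category.id_comp f).trans (act_comp g).symm)) :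
      (∐ fun _ : G => Y) ⟶ pullback f f)

/-- A scheme over `B` with a right action of `G` over `B`. -/
structure GScheme (G : Type u) [Group G] (B : Scheme.{u}) where
  total : Scheme.{u}
  proj : total ⟶ B
  action : RightAction G total
  act_proj : ∀ g : G, action.act g ≫ proj = proj

namespace GScheme

variable {G : Type u} [Group G] {B : Scheme.{u}}

/-- `G`-equivariant morphisms over `B`. -/
@[ext]
structure Hom (E F : GScheme G B) where
  hom : E.total ⟶ F.total
  hom_proj : hom ≫ F.proj = E.proj
  equivariant : ∀ g : G, E.action.act g ≫ hom = hom ≫ F.action.act g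

theorem act_proj_assoc (E : GScheme G B) (g : G) {Y : Scheme.{u}} (h : B ⟶ Y) :
    E.action.act g ≫ E.proj ≫ h = E.proj ≫ h := by
  rw [← Category.assoc, E.act_proj]

instance : Category (GScheme G B) where
  Hom E F := Hom E F
  id E := ⟨𝟙 E.total, Category.id_comp _, fun _ => by simp⟩
  comp f g := ⟨f.hom ≫ g.hom, by rw [Category.assoc, g.hom_proj, f.hom_proj], fun t => by
    rw [← Category.assoc, f.equivariant, Category.assoc, g.equivariant, Category.assoc]⟩
  id_comp f := Hom.ext (Category.id_comp _)
  comp_id f := Hom.ext (Category.comp_id _)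
  assoc f g h := Hom.ext (Category.assoc _ _ _)

@[ext]
theorem hom_ext {E F : GScheme G B} {f g : E ⟶ F} (h : f.hom = g.hom) : f = g := Hom.ext h

@[simp] theorem id_hom (E : GScheme G B) : Hom.hom (𝟙 E) = 𝟙 E.total := rfl

@[simp] theorem comp_hom {E F K : GScheme G B} (f : E ⟶ F) (g : F ⟶ K) :
    (f ≫ g).hom = f.hom ≫ g.hom := rfl

/-- The action on the first factor of `E ×_B B'`. -/
def pullAction {B' : Scheme.{u}} (a : B' ⟶ B) (E : GScheme G B) :
    RightAction G (pullback E.proj a) where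
  act t := pullback.lift (pullback.fst E.proj a ≫ E.action.act t)
    (pullback.snd E.proj a) (by rw [Category.assoc, E.act_proj, pullback.condition])
  act_one := by apply pullback.hom_ext <;> simp [E.action.act_one]
  act_mul g h := by
    apply pullback.hom_ext
    · rw [pullback.lift_fst, Category.assoc, pullback.lift_fst, pullback.lift_fst_assoc,
        E.action.act_mul, Category.assoc]
    · rw [pullback.lift_snd, Category.assoc, pullback.lift_snd, pullback.lift_snd]

/-- The pull-back `a^* E = E ×_B B'` along `a : B' ⟶ B`. -/
def pull {B' : Scheme.{u}} (a : B' ⟶ B) (E : GScheme G B) : GScheme G B' where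
  total := pullback E.proj a
  proj := pullback.snd E.proj a
  action := pullAction a E
  act_proj _ := pullback.lift_snd _ _ _

/-- The extension of structure group `E ×_α G` by an automorphism `α` of `G`, that is, the
quotient of `E × G` by the relation `(e t, t') ~ (e, α t t')`.  Evaluation
`(e, t) ↦ e · α⁻¹ t` identifies this quotient with `E` (see `extend_universal`), and
the right multiplication of `G` becomes the action `(e, t) ↦ e · α⁻¹ t` on `E`. -/
def extend (α : MulAut G) (E : GScheme G B) : GScheme G B where
  total := E.total
  proj := E.proj
  action :=
    { act := fun t => E.action.act (α⁻¹ t)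
      act_one := by simp [E.action.act_one]
      act_mul := fun g h => by simp [E.action.act_mul] }
  act_proj := fun t => E.act_proj _

/-- The evaluation `E × G ⟶ E, (e, t) ↦ e · α⁻¹ t` (on the copy of `E` with
index `t`) respects the relation `(e t, t') ~ (e, α t t')` and is universal among the maps
that do. -/
theorem extend_universal (α : MulAut G) (E : GScheme G B) :
    (∀ t t' : G, E.action.act t ≫ (E.extend α).action.act t' =
        (E.extend α).action.act (α t * t')) ∧
    ∀ (Y : Scheme.{u}) (h : G → (E.total ⟶ Y)),
      (∀ t t' : G, E.action.act t ≫ h t' = h (α t * t')) →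
        ∃! k : (E.extend α).total ⟶ Y, ∀ t : G, (E.extend α).action.act t ≫ k = h t := by
  refine ⟨fun t t' => ?_, fun Y h hh => ⟨h 1, fun t => ?_, fun k hk => ?_⟩⟩
  · simp [extend, E.action.act_mul]
  · simpa [extend] using hh (α⁻¹ t) 1
  · have := hk 1
    rw [(E.extend α).action.act_one] at this
    simpa using this

end GScheme

section Mumford

variable {T W : Type u} [CommGroup T] [Group W] {Z : Scheme.{u}}

variable (ρ : RightAction W Z) (σ : W →* MulAut T)

/-- The twisted action of `w : W` on `T`-schemes over `Z`: `w . E = w^* E ×_w T`, where `W` acts on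
`Z` from the right through `ρ` and on `T` through `σ`. -/
def twistObj (w : W) (E : GScheme T Z) : GScheme T Z :=
  (E.pull (ρ.act w)).extend (σ w)

section api

variable (w : W) (E : GScheme T Z)

/-- The canonical morphism `w . E = w^* E ×_w T ⟶ E ×_w T ⟶ E` covering the action of `w` on `Z`;
the second map is the evaluation `(e, t) ↦ e · w⁻¹ t`. -/
def twistEval : (twistObj ρ σ w E).total ⟶ E.total := pullback.fst E.proj (ρ.act w)

theorem twistEval_proj :
    twistEval ρ σ w E ≫ E.proj = (twistObj ρ σ w E).proj ≫ ρ.act w := pullback.condition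

theorem twistEval_proj_assoc {Y : Scheme.{u}} (h : Z ⟶ Y) :
    twistEval ρ σ w E ≫ E.proj ≫ h = (twistObj ρ σ w E).proj ≫ ρ.act w ≫ h := by
  rw [← Category.assoc, twistEval_proj, Category.assoc]

@[simp]
theorem act_twistEval (t : T) : (twistObj ρ σ w E).action.act t ≫ twistEval ρ σ w E =
    twistEval ρ σ w E ≫ E.action.act ((σ w)⁻¹ t) := pullback.lift_fst _ _ _

@[simp]
theorem act_twistEval_assoc (t : T) {Y : Scheme.{u}} (h : E.total ⟶ Y) :
    (twistObj ρ σ w E).action.act t ≫ twistEval ρ σ w E ≫ h =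
      twistEval ρ σ w E ≫ E.action.act ((σ w)⁻¹ t) ≫ h := by
  rw [← Category.assoc, act_twistEval, Category.assoc]

variable {w E}

/-- The universal property of `w . E` as a fibre product. -/
def twistLift {Y : Scheme.{u}} (f : Y ⟶ E.total) (g : Y ⟶ Z) (h : f ≫ E.proj = g ≫ ρ.act w) :
    Y ⟶ (twistObj ρ σ w E).total := pullback.lift f g h

@[simp]
theorem twistLift_eval {Y : Scheme.{u}} (f : Y ⟶ E.total) (g : Y ⟶ Z)
    (h : f ≫ E.proj = g ≫ ρ.act w) : twistLift ρ σ f g h ≫ twistEval ρ σ w E = f :=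
  pullback.lift_fst _ _ _

@[simp]
theorem twistLift_proj {Y : Scheme.{u}} (f : Y ⟶ E.total) (g : Y ⟶ Z)
    (h : f ≫ E.proj = g ≫ ρ.act w) : twistLift ρ σ f g h ≫ (twistObj ρ σ w E).proj = g :=
  pullback.lift_snd _ _ _

@[simp]
theorem twistLift_eval_assoc {Y Y' : Scheme.{u}} (f : Y ⟶ E.total) (g : Y ⟶ Z)
    (h : f ≫ E.proj = g ≫ ρ.act w) (k : E.total ⟶ Y') :
    twistLift ρ σ f g h ≫ twistEval ρ σ w E ≫ k = f ≫ k := by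
  rw [← Category.assoc, twistLift_eval]

@[simp]
theorem twistLift_proj_assoc {Y Y' : Scheme.{u}} (f : Y ⟶ E.total) (g : Y ⟶ Z)
    (h : f ≫ E.proj = g ≫ ρ.act w) (k : Z ⟶ Y') :
    twistLift ρ σ f g h ≫ (twistObj ρ σ w E).proj ≫ k = g ≫ k := by
  rw [← Category.assoc, twistLift_proj]

theorem twist_hom_ext {Y : Scheme.{u}} {f g : Y ⟶ (twistObj ρ σ w E).total}
    (h₁ : f ≫ twistEval ρ σ w E = g ≫ twistEval ρ σ w E)
    (h₂ : f ≫ (twistObj ρ σ w E).proj = g ≫ (twistObj ρ σ w E).proj) : f = g :=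
  pullback.hom_ext h₁ h₂

end api

/-- `E ↦ w . E` on morphisms. -/
def twistMap (w : W) {E F : GScheme T Z} (f : E ⟶ F) : twistObj ρ σ w E ⟶ twistObj ρ σ w F where
  hom := twistLift ρ σ (twistEval ρ σ w E ≫ f.hom) (twistObj ρ σ w E).proj
    (by rw [Category.assoc, f.hom_proj, twistEval_proj])
  hom_proj := by simp
  equivariant t := by
    apply twist_hom_ext <;> simp [f.equivariant, GScheme.act_proj]

/-- The twisted action of `w` as a functor. -/
def twist (w : W) : GScheme T Z ⥤ GScheme T Z where
  obj := twistObj ρ σ w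
  map := twistMap ρ σ w
  map_id E := by
    apply GScheme.hom_ext
    apply twist_hom_ext <;> simp [twistMap]
  map_comp f g := by
    apply GScheme.hom_ext
    apply twist_hom_ext <;> simp [twistMap]

variable (E : GScheme T Z)

/-- `w . E = E` for `w = 1`. -/
def twistUnit (w : W) (hw : w = 1) : E ≅ twistObj ρ σ w E where
  hom :=
    { hom := twistLift ρ σ (𝟙 _) E.proj (by simp [hw, ρ.act_one])
      hom_proj := by simp
      equivariant := fun t => by
        apply twist_hom_ext <;> simp [hw, GScheme.act_proj] }
  inv :=
    { hom := twistEval ρ σ w E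
      hom_proj := by simp [twistEval_proj, hw, ρ.act_one]
      equivariant := fun t => by simp [hw] }
  hom_inv_id := by
    apply GScheme.hom_ext
    simp
  inv_hom_id := by
    apply GScheme.hom_ext
    apply twist_hom_ext <;> simp [twistEval_proj, hw, ρ.act_one]

/-- The canonical identification `w₁ . (w₂ . E) = (w₁ w₂) . E`. -/
def twistMul (w₁ w₂ : W) :
    twistObj ρ σ w₁ (twistObj ρ σ w₂ E) ≅ twistObj ρ σ (w₁ * w₂) E where
  hom :=
    { hom := twistLift ρ σ
        (twistEval ρ σ w₁ (twistObj ρ σ w₂ E) ≫ twistEval ρ σ w₂ E)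
        (twistObj ρ σ w₁ (twistObj ρ σ w₂ E)).proj
        (by rw [Category.assoc, twistEval_proj, twistEval_proj_assoc, ρ.act_mul])
      hom_proj := by simp
      equivariant := fun t => by
        apply twist_hom_ext <;> simp [GScheme.act_proj] }
  inv :=
    { hom := twistLift ρ σ
        (twistLift ρ σ (twistEval ρ σ (w₁ * w₂) E) ((twistObj ρ σ (w₁ * w₂) E).proj ≫ ρ.act w₁)
          (by rw [twistEval_proj, Category.assoc, ρ.act_mul]))
        (twistObj ρ σ (w₁ * w₂) E).proj (by simp)
      hom_proj := by simp
      equivariant := fun t => by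
        apply twist_hom_ext
        · apply twist_hom_ext <;> simp [GScheme.act_proj, GScheme.act_proj_assoc]
        · simp [GScheme.act_proj] }
  hom_inv_id := by
    apply GScheme.hom_ext
    apply twist_hom_ext
    · apply twist_hom_ext <;> simp [twistEval_proj]
    · simp
  inv_hom_id := by
    apply GScheme.hom_ext
    apply twist_hom_ext <;> simp

/-- The Mumford group of `E`: pairs `(w, γ)` with `w : W` and `γ : E ⟶ w . E` an isomorphism of
`T`-bundles on `Z`. -/
structure MumfordGroup where
  w : W
  γ : E ≅ twistObj ρ σ w E

namespace MumfordGroup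

variable {ρ σ E}

/-- The morphism `μ_n : E ⟶ E` attached to `n = (w, γ)`: the composite
`E ⟶ w^* E ×_w T ⟶ E ×_w T ⟶ E` of `γ` and the canonical maps. -/
def μ (n : MumfordGroup ρ σ E) : E.total ⟶ E.total :=
  n.γ.hom.hom ≫ twistEval ρ σ n.w E

theorem ext_μ {n m : MumfordGroup ρ σ E} (hw : n.w = m.w) (h : n.μ = m.μ) : n = m := by
  obtain ⟨w, γ⟩ := n
  obtain ⟨w', γ'⟩ := m
  obtain rfl : w = w' := hw
  congr 1
  apply Iso.ext
  apply GScheme.hom_ext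
  apply pullback.hom_ext
  · exact h
  · exact γ.hom.hom_proj.trans γ'.hom.hom_proj.symm

/-- `(w₁, γ₁) (w₂, γ₂) = (w₁ w₂, w₁(γ₂) ∘ γ₁)`. -/
instance : Mul (MumfordGroup ρ σ E) where
  mul n₁ n₂ := ⟨n₁.w * n₂.w,
    n₁.γ ≪≫ (twist ρ σ n₁.w).mapIso n₂.γ ≪≫ twistMul ρ σ E n₁.w n₂.w⟩

instance : One (MumfordGroup ρ σ E) where
  one := ⟨1, twistUnit ρ σ E 1 rfl⟩

instance : Inv (MumfordGroup ρ σ E) where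
  inv n := ⟨n.w⁻¹, twistUnit ρ σ E (n.w⁻¹ * n.w) (inv_mul_cancel _) ≪≫
    (twistMul ρ σ E n.w⁻¹ n.w).symm ≪≫ (twist ρ σ n.w⁻¹).mapIso n.γ.symm⟩

theorem mul_w (n₁ n₂ : MumfordGroup ρ σ E) : (n₁ * n₂).w = n₁.w * n₂.w := rfl

theorem one_w : (1 : MumfordGroup ρ σ E).w = 1 := rfl

theorem inv_w (n : MumfordGroup ρ σ E) : (n⁻¹).w = n.w⁻¹ := rfl

theorem μ_one : (1 : MumfordGroup ρ σ E).μ = 𝟙 E.total :=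
  pullback.lift_fst _ _ _

theorem μ_mul (n₁ n₂ : MumfordGroup ρ σ E) : (n₁ * n₂).μ = n₁.μ ≫ n₂.μ := by
  have h : (n₁ * n₂).μ = (n₁.γ.hom.hom ≫ (twistMap ρ σ n₁.w n₂.γ.hom).hom ≫
    (twistMul ρ σ E n₁.w n₂.w).hom.hom) ≫ twistEval ρ σ (n₁.w * n₂.w) E := rfl
  rw [h]
  simp [μ, twistMap, twistMul]

theorem μ_inv_comp (n : MumfordGroup ρ σ E) : (n⁻¹).μ ≫ n.μ = 𝟙 E.total := by
  have h : (n⁻¹).μ = ((twistUnit ρ σ E (n.w⁻¹ * n.w) (inv_mul_cancel _)).hom.hom ≫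
    (twistMul ρ σ E n.w⁻¹ n.w).inv.hom ≫ (twistMap ρ σ n.w⁻¹ n.γ.inv).hom) ≫
      twistEval ρ σ n.w⁻¹ E := rfl
  have h' : n.γ.inv.hom ≫ n.γ.hom.hom ≫ twistEval ρ σ n.w E = twistEval ρ σ n.w E := by
    rw [← Category.assoc, ← GScheme.comp_hom, n.γ.inv_hom_id, GScheme.id_hom, Category.id_comp]
  rw [h]
  simp [μ, twistMap, twistMul, twistUnit, h']

instance : Group (MumfordGroup ρ σ E) :=
  Group.ofLeftAxioms
    (fun a b c => ext_μ (mul_assoc _ _ _) (by simp only [μ_mul, Category.assoc]))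
    (fun a => ext_μ (one_mul _) (by rw [μ_mul, μ_one, Category.id_comp]))
    (fun a => ext_μ (inv_mul_cancel _) (by rw [μ_mul, μ_inv_comp, μ_one]))

variable (ρ σ E)

/-- The right action of the Mumford group on `E`. -/
def action : RightAction (MumfordGroup ρ σ E) E.total where
  act n := n.μ
  act_one := μ_one
  act_mul := μ_mul

/-- Translation by `t : T` as an automorphism of the `T`-bundle `E`. -/
def translation (t : T) : E ≅ E where
  hom := ⟨E.action.act t, E.act_proj t, fun s => by
    rw [← E.action.act_mul, mul_comm, E.action.act_mul]⟩
  inv := ⟨E.action.act t⁻¹, E.act_proj _, fun s => by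
    rw [← E.action.act_mul, mul_comm, E.action.act_mul]⟩
  hom_inv_id := by
    apply GScheme.hom_ext
    simp [← E.action.act_mul, E.action.act_one]
  inv_hom_id := by
    apply GScheme.hom_ext
    simp [← E.action.act_mul, E.action.act_one]

theorem μ_translation (t : T) :
    μ (⟨1, translation E t ≪≫ twistUnit ρ σ E 1 rfl⟩ : MumfordGroup ρ σ E) = E.action.act t := by
  simp [μ, translation, twistUnit]

/-- The inclusion `T ⟶ G(E)`, `t ↦ (1, translation by t)`. -/
def incl : T →* MumfordGroup ρ σ E where
  toFun t := ⟨1, translation E t ≪≫ twistUnit ρ σ E 1 rfl⟩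
  map_one' := ext_μ rfl (by rw [μ_translation, μ_one, E.action.act_one])
  map_mul' s t := ext_μ (mul_one (1 : W)).symm
    (by rw [μ_mul, μ_translation, μ_translation, μ_translation, E.action.act_mul])

/-- The action of the Mumford group extends the action of `T`. -/
theorem action_incl (t : T) : (action ρ σ E).act (incl ρ σ E t) = E.action.act t :=
  μ_translation ρ σ E t

/-- The action of the Mumford group lifts the action of `W` on `Z`. -/
theorem action_proj (n : MumfordGroup ρ σ E) :
    (action ρ σ E).act n ≫ E.proj = E.proj ≫ ρ.act n.w := by
  change (n.γ.hom.hom ≫ twistEval ρ σ n.w E) ≫ E.proj = _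
  rw [Category.assoc, twistEval_proj, ← Category.assoc, n.γ.hom.hom_proj]

end MumfordGroup
end Mumford

section Product

variable {G H : Type u} [Group G] [Group H] {Y : Scheme.{u}}

/-- For a homomorphism `θ : G → H` and a right action of `G` on `Y`, the right action
`(y, h) · g = (y · g, θ(g)⁻¹ h)` of `G` on `Y × H`.  Its quotient is the contracted
product `Y ×^G H`. -/
def diagonalAction (θ : G →* H) (ρ : RightAction G Y) :
    RightAction G (∐ fun _ : H => Y) where
  act g := Sigma.desc fun h => ρ.act g ≫ Sigma.ι (fun _ : H => Y) ((θ g)⁻¹ * h)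
  act_one := by
    apply Sigma.hom_ext
    intro h
    simp [ρ.act_one]
  act_mul g g' := by
    apply Sigma.hom_ext
    intro h
    simp [ρ.act_mul, mul_assoc]

variable (H Y) in
/-- The right multiplication `(y, h) · m = (y, h m)` of `H` on `Y × H`. -/
def mulRightAction : RightAction H (∐ fun _ : H => Y) where
  act m := Sigma.desc fun h => Sigma.ι (fun _ : H => Y) (h * m)
  act_one := by
    apply Sigma.hom_ext
    intro h
    simp
  act_mul m m' := by
    apply Sigma.hom_ext
    intro h
    simp [mul_assoc]

end Product

section Linearisation

variable {T W : Type u} [CommGroup T] [Group W] {Z : Scheme.{u}}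

/-- Let `q : E × N ⟶ P` be the quotient defining `P = E ×^T N`, with `N` the Mumford
group of `E`.  The right action `Φ` of `W` on `P` is the canonical linearisation if it is induced
by the action `(e, n') · n = (e · n, n⁻¹ n')` of `N` on `E × N`. -/
def IsLinearisation (ρ : RightAction W Z) (σ : W →* MulAut T) (E : GScheme T Z) {P : Scheme.{u}}
    (q : (∐ fun _ : MumfordGroup ρ σ E => E.total) ⟶ P) (Φ : RightAction W P) : Prop :=
  ∀ n : MumfordGroup ρ σ E,
    (diagonalAction (MonoidHom.id _) (MumfordGroup.action ρ σ E)).act n ≫ q = q ≫ Φ.act n.w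

end Linearisation

end MumfordBundle

end

/-! The group N is an extension of W by T. Its projection to W is onto because E is W-invariant. The
kernel is T because an endomorphism of a bundle with commutative group over the connected Z is a
translation (`exists_hom_eq_act`). Hence N acts simply transitively on the fibres of E → X: an
element of W moves the base point in Z, a lift to N carries this to E, and an element of T makes the
remaining correction.

Checking this on one-point test schemes is enough (`IsPrincipalBundle.of_points`). Each graph y ↦
(y, yg) is a section of an étale projection, hence an open immersion, so the shear map is an
isomorphism once the graphs are disjoint and cover.

The quotients are explicit: (e, n) ↦ (en, w(n)) realises E ×^T N as E × W, and the N-invariant map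
(e, n) ↦ en realises its quotient by W as E. For an arbitrary model P, a section of E × N → P
(`exists_section`) descends T-invariant maps. For an arbitrary F, `isIso_sigmaι_comp` identifies E
with F, and the action and projection are transported along this isomorphism. -/

namespace MumfordBundle

/-! ### One-point test schemes; in practice, spectra of residue fields. -/

section Points

variable {S U V : Scheme.{u}} [Subsingleton S]

theorem exists_fac_of_mem_range (j : U ⟶ V) [IsOpenImmersion j] (c : S ⟶ V) (s : S)
    (h : c s ∈ Set.range j) : ∃ b : S ⟶ U, b ≫ j = c := by
  refine ⟨IsOpenImmersion.lift j c ?_, IsOpenImmersion.lift_fac _ _ _⟩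
  rintro _ ⟨s', rfl⟩
  rwa [Subsingleton.elim s' s]

theorem exists_fac_sigmaι [Nonempty S] {I : Type u} (Y : I → Scheme.{u}) (c : S ⟶ ∐ Y) :
    ∃ (i : I) (b : S ⟶ Y i), b ≫ Sigma.ι Y i = c := by
  obtain ⟨s⟩ := ‹Nonempty S›
  obtain ⟨i, y, hy⟩ := (sigmaOpenCover Y).exists_eq (c s)
  exact ⟨i, exists_fac_of_mem_range (Sigma.ι Y i) c s ⟨y, hy⟩⟩

omit [Subsingleton S] in
theorem eq_of_comp_sigmaι_eq [Nonempty S] {I : Type u} {Y : I → Scheme.{u}} {i j : I}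
    {a : S ⟶ Y i} {b : S ⟶ Y j} (h : a ≫ Sigma.ι Y i = b ≫ Sigma.ι Y j) : i = j := by
  by_contra hij
  exact (isEmpty_of_commSq_sigmaι_of_ne ⟨h⟩ hij).false (Classical.arbitrary S)

end Points

/-! ### Étale morphisms controlled by their points. -/

section Etale

variable {A B : Scheme.{u}}

theorem isOpenImmersion_of_etale_of_mono (f : A ⟶ B) [Etale f] [Mono f] : IsOpenImmersion f :=
  IsOpenImmersion.of_flat_of_mono f

theorem isIso_of_isOpenImmersion_of_surjective (f : A ⟶ B) [IsOpenImmersion f] [Surjective f] :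
    IsIso f :=
  isIso_of_isOpenImmersion_of_opensRange_eq_top f
    (TopologicalSpace.Opens.ext f.surjective.range_eq)

theorem etale_of_comp_eq_id {f : A ⟶ B} {g : B ⟶ A} [Etale g] (h : f ≫ g = 𝟙 A) : Etale f := by
  have : Etale (f ≫ g) := h ▸ inferInstance
  exact Etale.of_comp f g

/-- A section of an étale morphism is étale by cancellation and a split monomorphism; étale
monomorphisms are open immersions. -/
theorem isOpenImmersion_of_comp_eq_id {f : A ⟶ B} {g : B ⟶ A} [Etale g] (h : f ≫ g = 𝟙 A) :
    IsOpenImmersion f := by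
  have := etale_of_comp_eq_id h
  have : Mono f := ⟨fun a b hab => by simpa [h] using hab =≫ g⟩
  exact isOpenImmersion_of_etale_of_mono f

/-- An étale surjective morphism which is injective on field-valued points is an isomorphism. -/
theorem isIso_of_etale_of_injective_points (f : A ⟶ B) [Etale f] [Surjective f]
    (hf : ∀ (S : Scheme.{u}) [Subsingleton S] [Nonempty S] (x y : S ⟶ A),
      x ≫ f = y ≫ f → x = y) : IsIso f := by
  have hΔ : pullback.diagonal f ≫ pullback.fst f f = 𝟙 A := pullback.diagonal_fst f
  have := isOpenImmersion_of_comp_eq_id hΔ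
  -- By injectivity on points, the two projections of any point of the fibre product agree, so it
  -- factors through the diagonal. The diagonal is thus an isomorphism, which makes `f` a
  -- monomorphism.
  have : Surjective (pullback.diagonal f) := ⟨fun z => by
    let c := (pullback f f).fromSpecResidueField z
    have h : c ≫ pullback.fst f f = c ≫ pullback.snd f f :=
      hf _ _ _ (by simp [pullback.condition])
    have hc : (c ≫ pullback.fst f f) ≫ pullback.diagonal f = c := by
      apply pullback.hom_ext <;> simp [h]
    let s : Spec ((pullback f f).residueField z) := Classical.arbitrary _
    refine ⟨(c ≫ pullback.fst f f) s, ?_⟩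
    rw [← Scheme.Hom.comp_apply, hc, Scheme.fromSpecResidueField_apply]⟩
  have := isIso_of_isOpenImmersion_of_surjective (pullback.diagonal f)
  have : Mono f := pullback.isIso_diagonal_iff f |>.mp this
  have := isOpenImmersion_of_etale_of_mono f
  exact isIso_of_isOpenImmersion_of_surjective f

end Etale

/-! ### Principal bundles and simple transitivity on points. -/

namespace IsPrincipalBundle

variable {G : Type u} [Group G] {Y B : Scheme.{u}} {ρ : RightAction G Y} {f : Y ⟶ B}

/-- An étale surjective invariant morphism is a principal bundle as soon as the group acts simply
transitively on the fibres of field-valued points. -/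
theorem of_points [Etale f] [Surjective f] (hinv : ∀ g, ρ.act g ≫ f = f)
    (hex : ∀ (S : Scheme.{u}) [Subsingleton S] [Nonempty S] (x y : S ⟶ Y),
      x ≫ f = y ≫ f → ∃ g, x ≫ ρ.act g = y)
    (huniq : ∀ (S : Scheme.{u}) [Subsingleton S] [Nonempty S] (x : S ⟶ Y) (g h : G),
      x ≫ ρ.act g = x ≫ ρ.act h → g = h) : IsPrincipalBundle ρ f where
  etale := inferInstance
  surjective := inferInstance
  act_comp := hinv
  isIso_shear := by
    let Γ (g : G) : Y ⟶ pullback f f :=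
      pullback.lift (𝟙 Y) (ρ.act g) ((Category.id_comp f).trans (hinv g).symm)
    have hΓ (g : G) : Γ g ≫ pullback.fst f f = 𝟙 Y := pullback.lift_fst _ _ _
    have hΓ' (g : G) : Γ g ≫ pullback.snd f f = ρ.act g := pullback.lift_snd _ _ _
    have (g : G) : IsOpenImmersion (Γ g) := isOpenImmersion_of_comp_eq_id (hΓ g)
    have key (z : ↥(pullback f f)) : ∃ (S : Scheme.{u}) (_ : Subsingleton S) (_ : Nonempty S)
        (s : S) (c : S ⟶ pullback f f), c s = z :=
      ⟨Spec ((pullback f f).residueField z), inferInstance, inferInstance, Classical.arbitrary _,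
        (pullback f f).fromSpecResidueField z, Scheme.fromSpecResidueField_apply _ _⟩
    have : IsOpenImmersion (Sigma.desc Γ) := by
      refine isOpenImmersion_sigmaDesc _ _ fun g h hgh => ?_
      refine Set.disjoint_left.mpr fun z hg hh => hgh ?_
      obtain ⟨S, _, _, s, c, rfl⟩ := key z
      obtain ⟨a, ha⟩ := exists_fac_of_mem_range (Γ g) c s hg
      obtain ⟨b, hb⟩ := exists_fac_of_mem_range (Γ h) c s hh
      have ha' : a = c ≫ pullback.fst f f := by rw [← ha, Category.assoc, hΓ, Category.comp_id]
      have hb' : b = c ≫ pullback.fst f f := by rw [← hb, Category.assoc, hΓ, Category.comp_id]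
      obtain rfl : a = b := ha'.trans hb'.symm
      apply huniq S a
      rw [← hΓ', ← hΓ', ← Category.assoc, ← Category.assoc, ha, hb]
    have : Surjective (Sigma.desc Γ) := ⟨fun z => by
      obtain ⟨S, _, _, s, c, rfl⟩ := key z
      obtain ⟨g, hg⟩ := hex S (c ≫ pullback.fst f f) (c ≫ pullback.snd f f)
        (by simp [pullback.condition])
      have : (c ≫ pullback.fst f f) ≫ Sigma.ι (fun _ : G => Y) g ≫ Sigma.desc Γ = c := by
        rw [Sigma.ι_desc]
        apply pullback.hom_ext
        · rw [Category.assoc, hΓ, Category.comp_id]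
        · rw [Category.assoc, hΓ', hg]
      refine ⟨((c ≫ pullback.fst f f) ≫ Sigma.ι (fun _ : G => Y) g) s, ?_⟩
      rw [← Scheme.Hom.comp_apply, Category.assoc, this]⟩
    exact isIso_of_isOpenImmersion_of_surjective (Sigma.desc Γ)

variable (hf : IsPrincipalBundle ρ f)
include hf

/-- The inverse of the shear map sends the point (x, y) into a single summand of the coproduct,
whose index is the required group element. -/
theorem exists_act_eq {S : Scheme.{u}} [Subsingleton S] [Nonempty S] {x y : S ⟶ Y}
    (h : x ≫ f = y ≫ f) : ∃ g, x ≫ ρ.act g = y := by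
  have := hf.isIso_shear
  set φ := Sigma.desc fun g : G => pullback.lift (𝟙 Y) (ρ.act g)
    ((Category.id_comp f).trans (hf.act_comp g).symm) with hφ
  obtain ⟨g, b, hb⟩ := exists_fac_sigmaι _ (pullback.lift x y h ≫ inv φ)
  rw [IsIso.eq_comp_inv, Category.assoc, hφ, Sigma.ι_desc] at hb
  have h₁ := hb =≫ pullback.fst f f
  have h₂ := hb =≫ pullback.snd f f
  simp only [Category.assoc, pullback.lift_fst, pullback.lift_snd, Category.comp_id] at h₁ h₂
  exact ⟨g, h₁ ▸ h₂⟩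

theorem eq_of_act_eq {S : Scheme.{u}} [Nonempty S] {x : S ⟶ Y} {g h : G}
    (hgh : x ≫ ρ.act g = x ≫ ρ.act h) : g = h := by
  have := hf.isIso_shear
  set φ := Sigma.desc fun g : G => pullback.lift (𝟙 Y) (ρ.act g)
    ((Category.id_comp f).trans (hf.act_comp g).symm) with hφ
  apply eq_of_comp_sigmaι_eq (Y := fun _ : G => Y) (a := x) (b := x)
  rw [← cancel_mono φ, Category.assoc, Category.assoc, hφ, Sigma.ι_desc, Sigma.ι_desc]
  apply pullback.hom_ext <;>
    simp only [Category.assoc, pullback.lift_fst, pullback.lift_snd, hgh]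

end IsPrincipalBundle

/-! ### Endomorphisms of a bundle over a connected base. -/

section

variable {T : Type u} [CommGroup T] {Z : Scheme.{u}} [ConnectedSpace Z] {E : GScheme T Z}

/-- The endomorphisms of a principal bundle with commutative group on a connected scheme are the
translations. -/
theorem exists_hom_eq_act (hE : IsPrincipalBundle E.action E.proj) (φ : E ⟶ E) :
    ∃ t : T, φ.hom = E.action.act t := by
  have := hE.etale
  have := hE.surjective
  have hp : IsOpenMap E.proj := E.proj.isOpenMap
  let Γ (t : T) : E.total ⟶ pullback E.proj E.proj :=
    pullback.lift (𝟙 _) (E.action.act t) ((Category.id_comp _).trans (hE.act_comp t).symm)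
  have hΓ (t : T) : Γ t ≫ pullback.fst _ _ = 𝟙 _ := pullback.lift_fst _ _ _
  have hΓ' (t : T) : Γ t ≫ pullback.snd _ _ = E.action.act t := pullback.lift_snd _ _ _
  have (t : T) : IsOpenImmersion (Γ t) := isOpenImmersion_of_comp_eq_id (hΓ t)
  let ψ : E.total ⟶ pullback E.proj E.proj :=
    pullback.lift (𝟙 _) φ.hom ((Category.id_comp _).trans φ.hom_proj.symm)
  have hψ : ψ ≫ pullback.fst _ _ = 𝟙 _ := pullback.lift_fst _ _ _
  have hψ' : ψ ≫ pullback.snd _ _ = φ.hom := pullback.lift_snd _ _ _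
  -- The locus where φ agrees with translation by t: the graph of t is open, so its preimage under
  -- the graph ψ of φ is open.
  let D (t : T) : Set E.total := ψ ⁻¹' Set.range (Γ t)
  have hD (t : T) : IsOpen (D t) := (Γ t).isOpenEmbedding.isOpen_range.preimage ψ.continuous
  have point_act {S : Scheme.{u}} [Subsingleton S] [Nonempty S] (x : S ⟶ E.total) (s : S) (t : T)
      (h : x s ∈ D t) : x ≫ φ.hom = x ≫ E.action.act t := by
    obtain ⟨b, hb⟩ := exists_fac_of_mem_range (Γ t) (x ≫ ψ) s h
    have h₁ := hb =≫ pullback.fst _ _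
    have h₂ := hb =≫ pullback.snd _ _
    simp only [Category.assoc, hΓ, hΓ', hψ, hψ', Category.comp_id] at h₁ h₂
    rw [← h₂, h₁]
  have cover (e : E.total) : ∃ t, e ∈ D t := by
    let x := E.total.fromSpecResidueField e
    let s : Spec (E.total.residueField e) := Classical.arbitrary _
    have hx : x s = e := Scheme.fromSpecResidueField_apply _ _
    obtain ⟨t, ht⟩ := hE.exists_act_eq (x := x) (y := x ≫ φ.hom)
      (by rw [Category.assoc, φ.hom_proj])
    refine ⟨t, x s, ?_⟩
    have h : x ≫ Γ t = x ≫ ψ := by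
      apply pullback.hom_ext
      · rw [Category.assoc, hΓ, Category.assoc, hψ]
      · rw [Category.assoc, hΓ', Category.assoc, hψ', ht]
    rw [← Scheme.Hom.comp_apply, h, Scheme.Hom.comp_apply, hx]
  -- Write two points over the same point of Z as x and xu. Then φ(xu) = φ(x)u gives x·tu = x·ut',
  -- so t = t' by freeness and commutativity. The images of the `D t` in Z are therefore disjoint.
  have unique (e e' : E.total) (t t' : T) (he : e ∈ D t) (he' : e' ∈ D t')
      (h : E.proj e = E.proj e') : t = t' := by
    obtain ⟨z, rfl, rfl⟩ := Scheme.Pullback.exists_preimage_pullback e e' h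
    let c := (pullback E.proj E.proj).fromSpecResidueField z
    let s : Spec ((pullback E.proj E.proj).residueField z) := Classical.arbitrary _
    have hc : c s = z := Scheme.fromSpecResidueField_apply _ _
    rw [← hc, ← Scheme.Hom.comp_apply] at he he'
    have hx := point_act _ s t he
    have hy := point_act _ s t' he'
    obtain ⟨u, hu⟩ := hE.exists_act_eq (x := c ≫ pullback.fst _ _) (y := c ≫ pullback.snd _ _)
      (by simp [pullback.condition])
    rw [← hu, Category.assoc, φ.equivariant, ← Category.assoc, hx, Category.assoc (_ ≫ _), Category.assoc (_ ≫ _),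
      ← E.action.act_mul, ← E.action.act_mul] at hy
    exact mul_left_cancel (mul_comm u t ▸ hE.eq_of_act_eq hy)
  obtain ⟨z₀⟩ : Nonempty Z := inferInstance
  obtain ⟨e₀, -⟩ := E.proj.surjective z₀
  obtain ⟨t, ht⟩ := cover e₀
  have hclopen : IsClopen (E.proj '' D t) := by
    refine ⟨?_, hp _ (hD t)⟩
    have : (E.proj '' D t)ᶜ = ⋃ t' ∈ {t' | t' ≠ t}, E.proj '' D t' := by
      ext z
      simp only [Set.mem_compl_iff, Set.mem_iUnion, Set.mem_ofPred_eq, exists_prop]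
      constructor
      · intro hz
        obtain ⟨e, rfl⟩ := E.proj.surjective z
        obtain ⟨t', he⟩ := cover e
        exact ⟨t', fun h => hz ⟨e, h ▸ he, rfl⟩, e, he, rfl⟩
      · rintro ⟨t', ht', e', he', rfl⟩ ⟨e, he, h⟩
        exact ht' (unique e e' t t' he he' h).symm
    rw [← isOpen_compl_iff, this]
    exact isOpen_biUnion fun t' _ => hp _ (hD t')
  have huniv : E.proj '' D t = Set.univ := hclopen.eq_univ ⟨_, e₀, ht, rfl⟩
  have hall (e : E.total) : e ∈ D t := by
    obtain ⟨e', he', h⟩ : E.proj e ∈ E.proj '' D t := huniv ▸ Set.mem_univ _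
    obtain ⟨t', he⟩ := cover e
    exact unique e' e t t' he' he h ▸ he
  refine ⟨t, ?_⟩
  -- Set-theoretic containment in an open subscheme already factors ψ through Γ t as a morphism, so
  -- the equality holds on schemes and not only on points.
  have hfac : IsOpenImmersion.lift (Γ t) ψ (by rintro _ ⟨e, rfl⟩; exact hall e) ≫ Γ t = ψ :=
    IsOpenImmersion.lift_fac _ _ _
  have h₁ := hfac =≫ pullback.fst _ _
  have h₂ := hfac =≫ pullback.snd _ _
  rw [Category.assoc, hΓ, Category.comp_id, hψ] at h₁
  rw [h₁, Category.id_comp, hΓ', hψ'] at h₂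
  exact h₂.symm

end

/-! ### Actions on coproducts of copies of a scheme. -/

section Actions

variable {G H : Type u} [Group G] [Group H] {Y : Scheme.{u}}

theorem RightAction.isIso_act (ρ : RightAction G Y) (g : G) : IsIso (ρ.act g) :=
  ⟨ρ.act g⁻¹, by rw [← ρ.act_mul, mul_inv_cancel, ρ.act_one],
    by rw [← ρ.act_mul, inv_mul_cancel, ρ.act_one]⟩

theorem sigmaι_diagonalAction (θ : G →* H) (ρ : RightAction G Y) (g : G) (h : H) :
    Sigma.ι (fun _ : H => Y) h ≫ (diagonalAction θ ρ).act g =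
      ρ.act g ≫ Sigma.ι (fun _ : H => Y) ((θ g)⁻¹ * h) :=
  Sigma.ι_desc _ _

theorem sigmaι_diagonalAction_assoc (θ : G →* H) (ρ : RightAction G Y) (g : G) (h : H)
    {Y' : Scheme.{u}} (k : (∐ fun _ : H => Y) ⟶ Y') :
    Sigma.ι (fun _ : H => Y) h ≫ (diagonalAction θ ρ).act g ≫ k =
      ρ.act g ≫ Sigma.ι (fun _ : H => Y) ((θ g)⁻¹ * h) ≫ k := by
  rw [← Category.assoc, sigmaι_diagonalAction, Category.assoc]

theorem sigmaι_mulRightAction (m h : H) :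
    Sigma.ι (fun _ : H => Y) h ≫ (mulRightAction H Y).act m = Sigma.ι (fun _ : H => Y) (h * m) :=
  Sigma.ι_desc _ _

theorem surjective_of_comp_eq_id {A B : Scheme.{u}} {f : A ⟶ B} {g : B ⟶ A} (h : f ≫ g = 𝟙 A) :
    Surjective g := by
  have : Surjective (f ≫ g) := h ▸ inferInstance
  exact Surjective.of_comp f g

theorem etale_sigmaDesc {I : Type u} {Y : I → Scheme.{u}} {B : Scheme.{u}} (f : ∀ i, Y i ⟶ B)
    (hf : ∀ i, Etale (f i)) : Etale (Sigma.desc f) :=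
  have : IsZariskiLocalAtSource @Etale.{u} :=
    HasRingHomProperty.instIsZariskiLocalAtSource (Q := RingHom.Etale)
  IsZariskiLocalAtSource.sigmaDesc hf

end Actions

/-! ### The Mumford group as an extension of W by T, and its bundle on X. -/

namespace MumfordGroup

variable {T W : Type u} [CommGroup T] [Group W] {Z : Scheme.{u}} {ρ : RightAction W Z}
  {σ : W →* MulAut T} {E : GScheme T Z}

theorem isIso_μ (n : MumfordGroup ρ σ E) : IsIso n.μ := (action ρ σ E).isIso_act n

theorem μ_proj (n : MumfordGroup ρ σ E) : n.μ ≫ E.proj = E.proj ≫ ρ.act n.w :=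
  action_proj ρ σ E n

theorem μ_incl (t : T) : (incl ρ σ E t).μ = E.action.act t := action_incl ρ σ E t

theorem incl_w (t : T) : (incl ρ σ E t).w = 1 := rfl

theorem w_surjective (hinv : ∀ w : W, Nonempty (E ≅ twistObj ρ σ w E)) (w : W) :
    ∃ n : MumfordGroup ρ σ E, n.w = w :=
  ⟨⟨w, (hinv w).some⟩, rfl⟩

variable [ConnectedSpace Z] (hE : IsPrincipalBundle E.action E.proj)
include hE

/-- The kernel of the projection of the Mumford group to `W` consists of the translations. -/
theorem exists_incl_eq (n : MumfordGroup ρ σ E) (hn : n.w = 1) : ∃ t : T, incl ρ σ E t = n := by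
  obtain ⟨t, ht⟩ := exists_hom_eq_act hE (n.γ.hom ≫ (twistUnit ρ σ E n.w hn).inv)
  exact ⟨t, ext_μ hn.symm ((μ_incl t).trans ht.symm)⟩

theorem exists_incl_mul_eq (n m : MumfordGroup ρ σ E) (h : n.w = m.w) :
    ∃ t : T, incl ρ σ E t * n = m := by
  obtain ⟨t, ht⟩ := exists_incl_eq hE (m * n⁻¹) (by rw [mul_w, inv_w, h, mul_inv_cancel])
  exact ⟨t, by rw [ht, inv_mul_cancel_right]⟩

/-- Transitivity: match the images in Z by some w, lift w to n, then correct xn by an element of T.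
Freeness: if xn = xm, then n and m agree in W, so m = tn; cancelling n leaves x = xt. -/
theorem isPrincipalBundle {X : Scheme.{u}} {π : Z ⟶ X} (hπ : IsPrincipalBundle ρ π)
    (hinv : ∀ w : W, Nonempty (E ≅ twistObj ρ σ w E)) :
    IsPrincipalBundle (action ρ σ E) (E.proj ≫ π) := by
  have := hE.etale
  have := hE.surjective
  have := hπ.etale
  have := hπ.surjective
  refine .of_points (fun n => ?_) (fun S _ _ x y hxy => ?_) fun S _ _ x n m h => ?_
  · rw [← Category.assoc, action_proj, Category.assoc, hπ.act_comp]
  · obtain ⟨w, hw⟩ := hπ.exists_act_eq (x := x ≫ E.proj) (y := y ≫ E.proj) (by simpa using hxy)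
    obtain ⟨n, rfl⟩ := w_surjective hinv w
    obtain ⟨t, ht⟩ := hE.exists_act_eq (x := x ≫ n.μ) (y := y)
      (by rw [Category.assoc, μ_proj, ← Category.assoc, hw])
    refine ⟨n * incl ρ σ E t, ?_⟩
    rw [(action ρ σ E).act_mul, action_incl, ← Category.assoc]
    exact ht
  · have hw : n.w = m.w := hπ.eq_of_act_eq (x := x ≫ E.proj) (by
      have := h =≫ E.proj
      rwa [Category.assoc, Category.assoc, action_proj, action_proj, ← Category.assoc,
        ← Category.assoc] at this)
    obtain ⟨t, rfl⟩ := exists_incl_mul_eq hE n m hw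
    have := isIso_μ n
    have ht : x ≫ E.action.act 1 = x ≫ E.action.act t := by
      rw [← cancel_mono n.μ, Category.assoc, Category.assoc, ← μ_incl (ρ := ρ) (σ := σ) t, ← μ_mul,
        E.action.act_one, Category.id_comp]
      exact h
    rw [← hE.eq_of_act_eq ht, map_one, one_mul]

/-- `E × W`, with `(e, n) ↦ (e n, w(n))`, is the contracted product of `E` and its Mumford
group over `T`. -/
theorem isPrincipalBundle_sigmaDesc_μ (hinv : ∀ w : W, Nonempty (E ≅ twistObj ρ σ w E)) :
    IsPrincipalBundle (diagonalAction (incl ρ σ E) E.action)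
      (Sigma.desc fun n : MumfordGroup ρ σ E => n.μ ≫ Sigma.ι (fun _ : W => E.total) n.w) := by
  set q := Sigma.desc fun n : MumfordGroup ρ σ E => n.μ ≫ Sigma.ι (fun _ : W => E.total) n.w
    with hq
  have hιq (n : MumfordGroup ρ σ E) : Sigma.ι (fun _ : MumfordGroup ρ σ E => E.total) n ≫ q =
      n.μ ≫ Sigma.ι (fun _ : W => E.total) n.w := Sigma.ι_desc _ _
  have : Etale q := etale_sigmaDesc _ fun n => by
    have := isIso_μ n
    infer_instance
  choose l hl using w_surjective hinv
  have := fun w => isIso_μ (l w)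
  -- With l a set-theoretic section of N → W, the map (e, w) ↦ (e l(w)⁻¹, l(w)) is a section of q.
  have : Surjective q := surjective_of_comp_eq_id
    (f := Sigma.desc fun w : W => inv (l w).μ ≫ Sigma.ι (fun _ : MumfordGroup ρ σ E => E.total) (l w)) (by
      apply Sigma.hom_ext
      intro w
      rw [Sigma.ι_desc_assoc, Category.assoc, hιq, IsIso.inv_hom_id_assoc, hl, Category.comp_id])
  refine .of_points (fun t => ?_) (fun S _ _ x y hxy => ?_) fun S _ _ x s t h => ?_
  · apply Sigma.hom_ext
    intro n
    rw [sigmaι_diagonalAction_assoc, hιq, hιq, ← μ_incl (ρ := ρ) (σ := σ), ← Category.assoc,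
      ← μ_mul, mul_inv_cancel_left]
    rw [mul_w, inv_w, incl_w, inv_one, one_mul]
  · obtain ⟨n, x, rfl⟩ := exists_fac_sigmaι _ x
    obtain ⟨m, y, rfl⟩ := exists_fac_sigmaι _ y
    simp only [Category.assoc, hιq] at hxy
    have hw : m.w = n.w := by
      rw [← Category.assoc, ← Category.assoc] at hxy
      exact (eq_of_comp_sigmaι_eq hxy).symm
    obtain ⟨t, rfl⟩ := exists_incl_mul_eq hE m n hw
    refine ⟨t, ?_⟩
    rw [← hw, ← Category.assoc, ← Category.assoc, cancel_mono, μ_mul, ← Category.assoc] at hxy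
    have := isIso_μ m
    rw [cancel_mono, μ_incl] at hxy
    rw [Category.assoc, sigmaι_diagonalAction, inv_mul_cancel_left, ← Category.assoc, hxy]
  · obtain ⟨n, x, rfl⟩ := exists_fac_sigmaι _ x
    simp only [Category.assoc, sigmaι_diagonalAction] at h
    rw [← Category.assoc, ← Category.assoc] at h
    have hst : (incl ρ σ E s)⁻¹ * n = (incl ρ σ E t)⁻¹ * n := eq_of_comp_sigmaι_eq h
    rw [hst, cancel_mono] at h
    exact hE.eq_of_act_eq h

/-! ### An arbitrary model P of the contracted product and its quotient by W. -/

section ContractedProduct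

variable (hinv : ∀ w : W, Nonempty (E ≅ twistObj ρ σ w E)) {P : Scheme.{u}}
  {q : (∐ fun _ : MumfordGroup ρ σ E => E.total) ⟶ P}
  (hq : IsPrincipalBundle (diagonalAction (incl ρ σ E) E.action) q)
include hinv hq

/-- The quotient map `E × N ⟶ E ×^T N` has a section, and every `T`-invariant map factors through
it. -/
theorem exists_section : ∃ s : P ⟶ ∐ fun _ : MumfordGroup ρ σ E => E.total, s ≫ q = 𝟙 P ∧
    ∀ (Y : Scheme.{u}) (h : (∐ fun _ : MumfordGroup ρ σ E => E.total) ⟶ Y),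
      (∀ t, (diagonalAction (incl ρ σ E) E.action).act t ≫ h = h) → q ≫ s ≫ h = h := by
  have := hq.etale
  have := hq.surjective
  choose l hl using w_surjective hinv
  choose τ hτ using fun n : MumfordGroup ρ σ E => exists_incl_mul_eq hE (l n.w) n (hl n.w)
  let s : (∐ fun _ : W => E.total) ⟶ ∐ fun _ : MumfordGroup ρ σ E => E.total :=
    Sigma.desc fun w => Sigma.ι (fun _ : MumfordGroup ρ σ E => E.total) (l w)
  have hιs (w : W) : Sigma.ι (fun _ : W => E.total) w ≫ s =
    Sigma.ι (fun _ : MumfordGroup ρ σ E => E.total) (l w) := Sigma.ι_desc _ _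
  -- Acting by τ(n) moves (e, n) to (e τ(n), l(w(n))), its representative in the T-orbit lying over
  -- the chosen lifts; d remembers only w(n).
  let d : (∐ fun _ : MumfordGroup ρ σ E => E.total) ⟶ ∐ fun _ : W => E.total :=
    Sigma.desc fun n => E.action.act (τ n) ≫ Sigma.ι (fun _ : W => E.total) n.w
  have hd (Y : Scheme.{u}) (h : (∐ fun _ : MumfordGroup ρ σ E => E.total) ⟶ Y)
      (hh : ∀ t, (diagonalAction (incl ρ σ E) E.action).act t ≫ h = h) : d ≫ s ≫ h = h := by
    apply Sigma.hom_ext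
    intro n
    rw [Sigma.ι_desc_assoc, Category.assoc, reassoc_of% hιs]
    conv_rhs => rw [← hh (τ n), sigmaι_diagonalAction_assoc]
    rw [← eq_inv_mul_of_mul_eq (hτ n)]
  have hdq : d ≫ s ≫ q = q := hd _ q hq.act_comp
  have : Etale s := etale_sigmaDesc _ fun w => inferInstance
  have : Surjective (d ≫ s ≫ q) := hdq.symm ▸ hq.surjective
  have : Surjective (s ≫ q) := Surjective.of_comp d (s ≫ q)
  -- If t takes (x, l(w)) to (y, l(w')), comparison in W gives w = w'; then t becomes trivial in N,
  -- so x = y.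
  have : IsIso (s ≫ q) := isIso_of_etale_of_injective_points _ fun S _ _ x y hxy => by
    obtain ⟨w, x, rfl⟩ := exists_fac_sigmaι _ x
    obtain ⟨w', y, rfl⟩ := exists_fac_sigmaι _ y
    simp only [Category.assoc, reassoc_of% hιs] at hxy
    rw [← Category.assoc, ← Category.assoc] at hxy
    obtain ⟨t, ht⟩ := hq.exists_act_eq hxy
    rw [Category.assoc, sigmaι_diagonalAction, ← Category.assoc] at ht
    have hw := eq_of_comp_sigmaι_eq ht
    obtain rfl : w = w' := by
      simpa only [mul_w, inv_w, incl_w, inv_one, one_mul, hl] using congrArg MumfordGroup.w hw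
    rw [hw, cancel_mono] at ht
    have h1 : incl ρ σ E t = 1 := by simpa using hw
    rw [← μ_incl (ρ := ρ) (σ := σ), h1, μ_one, Category.comp_id] at ht
    rw [ht]
  refine ⟨inv (s ≫ q) ≫ s, by simp, fun Y h hh => ?_⟩
  have : q ≫ inv (s ≫ q) = d := by
    rw [IsIso.comp_inv_eq]
    exact hdq.symm
  rw [Category.assoc, reassoc_of% this, hd _ h hh]

theorem epi_of_isPrincipalBundle : Epi q := by
  obtain ⟨s, hs, -⟩ := exists_section hE hinv hq
  have : IsSplitEpi q := ⟨⟨⟨s, hs⟩⟩⟩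
  infer_instance

omit hinv in
/-- The image of `(e n, n⁻¹ n')` in `E ×^T N` depends on `n` only through its image in `W`. -/
theorem diagonalAction_comp_eq (n m : MumfordGroup ρ σ E) (h : n.w = m.w) :
    (diagonalAction (MonoidHom.id _) (action ρ σ E)).act n ≫ q =
      (diagonalAction (MonoidHom.id _) (action ρ σ E)).act m ≫ q := by
  obtain ⟨t, rfl⟩ := exists_incl_mul_eq hE n m h
  -- Normality of T: tn = nt', and the final action by t' is absorbed by q.
  obtain ⟨t', ht'⟩ := exists_incl_eq hE (n⁻¹ * incl ρ σ E t * n) (by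
    rw [mul_w, mul_w, inv_w, incl_w, mul_one, inv_mul_cancel])
  have : incl ρ σ E t * n = n * incl ρ σ E t' := by rw [ht']; group
  have hd : (diagonalAction (MonoidHom.id _) (action ρ σ E)).act (incl ρ σ E t') =
      (diagonalAction (incl ρ σ E) E.action).act t' := by
    apply Sigma.hom_ext
    intro m
    rw [sigmaι_diagonalAction, sigmaι_diagonalAction, action_incl]
    rfl
  rw [this, RightAction.act_mul, Category.assoc, hd, hq.act_comp]

/-- The action of N followed by q is T-invariant and depends only on the class in W, so it descends
along q. Since q is epi, the action laws and uniqueness can be tested on E × N. -/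
theorem existsUnique_isLinearisation : ∃! Φ : RightAction W P, IsLinearisation ρ σ E q Φ := by
  have := epi_of_isPrincipalBundle hE hinv hq
  obtain ⟨s, hs, hfac⟩ := exists_section hE hinv hq
  choose l hl using w_surjective hinv
  set D := diagonalAction (MonoidHom.id _) (action ρ σ E) with hD
  -- The T-action is the restriction of the diagonal N-action, so acting by t and then n is acting
  -- by tn, which has the same image in W as n.
  have hinvariant (n : MumfordGroup ρ σ E) (t : T) :
      (diagonalAction (incl ρ σ E) E.action).act t ≫ D.act n ≫ q = D.act n ≫ q := by
    have hd : (diagonalAction (incl ρ σ E) E.action).act t = D.act (incl ρ σ E t) := by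
      apply Sigma.hom_ext
      intro m
      rw [sigmaι_diagonalAction, sigmaι_diagonalAction, action_incl]
      rfl
    rw [hd, ← Category.assoc, ← D.act_mul]
    exact diagonalAction_comp_eq hE hq _ _ (by rw [mul_w, incl_w, one_mul])
  have key (n : MumfordGroup ρ σ E) : q ≫ s ≫ D.act (l n.w) ≫ q = D.act n ≫ q := by
    rw [hfac _ _ (hinvariant _)]
    exact diagonalAction_comp_eq hE hq _ _ (hl _)
  refine ⟨⟨fun w => s ≫ D.act (l w) ≫ q, ?_, fun g h => ?_⟩, fun n => (key n).symm,
    fun Φ hΦ => ?_⟩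
  · rw [← cancel_epi q]
    have := key 1
    rwa [one_w, D.act_one, Category.id_comp, ← Category.comp_id q] at this
  · rw [← cancel_epi q]
    have h₁ := key (l g * l h)
    have h₂ := key (l g)
    have h₃ := key (l h)
    simp only [mul_w, hl] at h₁ h₂ h₃
    rw [h₁, Category.assoc, Category.assoc, reassoc_of% h₂, h₃, D.act_mul, Category.assoc]
  · ext w : 2
    rw [← cancel_epi q]
    have := hΦ (l w)
    rw [hl] at this
    rw [← this, hfac _ _ (hinvariant _)]

variable {Φ : RightAction W P} (hΦ : IsLinearisation ρ σ E q Φ)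
include hΦ

/-- The quotient is E itself: (e, n) ↦ en is unchanged by the diagonal N-action, hence descends to P
as `s ≫ ν`. -/
theorem exists_isPrincipalBundle_of_isLinearisation :
    ∃ (F : Scheme.{u}) (r : P ⟶ F), IsPrincipalBundle Φ r := by
  have := hq.etale
  have := epi_of_isPrincipalBundle hE hinv hq
  obtain ⟨s, hs, hfac⟩ := exists_section hE hinv hq
  let ν : (∐ fun _ : MumfordGroup ρ σ E => E.total) ⟶ E.total := Sigma.desc μ
  have hν (n : MumfordGroup ρ σ E) : Sigma.ι (fun _ => E.total) n ≫ ν = n.μ := Sigma.ι_desc _ _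
  have hνD (n : MumfordGroup ρ σ E) :
      (diagonalAction (MonoidHom.id _) (action ρ σ E)).act n ≫ ν = ν := by
    apply Sigma.hom_ext
    intro m
    rw [sigmaι_diagonalAction_assoc, hν, hν]
    change n.μ ≫ μ (n⁻¹ * m) = _
    rw [← μ_mul, mul_inv_cancel_left]
  have hqs : q ≫ s ≫ ν = ν := hfac _ _ fun t => by
    apply Sigma.hom_ext
    intro m
    rw [sigmaι_diagonalAction_assoc, hν, hν, ← μ_incl (ρ := ρ) (σ := σ), ← μ_mul,
      mul_inv_cancel_left]
  have : Etale s := etale_of_comp_eq_id hs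
  have : Etale ν := etale_sigmaDesc _ fun n => by
    have := isIso_μ n
    infer_instance
  have : Surjective (q ≫ s ≫ ν) := hqs.symm ▸ surjective_of_comp_eq_id
    (f := Sigma.ι (fun _ : MumfordGroup ρ σ E => E.total) 1) ((hν 1).trans μ_one)
  have : Surjective (s ≫ ν) := Surjective.of_comp q (s ≫ ν)
  have lift {S : Scheme.{u}} [Subsingleton S] [Nonempty S] (x : S ⟶ P) :
      ∃ (n : MumfordGroup ρ σ E) (x' : S ⟶ E.total), x' ≫ Sigma.ι (fun _ => E.total) n ≫ q = x := by
    obtain ⟨n, x', hx'⟩ := exists_fac_sigmaι _ (x ≫ s)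
    exact ⟨n, x', by rw [← Category.assoc, hx', Category.assoc, hs, Category.comp_id]⟩
  have hιΦ (n m : MumfordGroup ρ σ E) : Sigma.ι (fun _ => E.total) n ≫ q ≫ Φ.act m.w =
      m.μ ≫ Sigma.ι (fun _ => E.total) (m⁻¹ * n) ≫ q := by
    rw [← hΦ, sigmaι_diagonalAction_assoc]
    rfl
  refine ⟨E.total, s ≫ ν, .of_points (fun w => ?_) (fun S _ _ x y hxy => ?_)
    fun S _ _ x w w' h => ?_⟩
  · obtain ⟨n, rfl⟩ := w_surjective hinv w
    rw [← cancel_epi q, ← Category.assoc, ← hΦ, Category.assoc, hqs, hνD]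
  · obtain ⟨n, x, rfl⟩ := lift x
    obtain ⟨m, y, rfl⟩ := lift y
    simp only [Category.assoc, hqs, hν] at hxy
    -- Acting by nm⁻¹ takes (x, n) to (xnm⁻¹, m), which is (y, m) since xn = ym.
    refine ⟨(n * m⁻¹).w, ?_⟩
    rw [Category.assoc, Category.assoc, hιΦ, μ_mul, Category.assoc, reassoc_of% hxy,
      ← Category.assoc m.μ, ← μ_mul, mul_inv_cancel, μ_one, Category.id_comp, mul_inv_rev, inv_inv,
      inv_mul_cancel_right]
  · obtain ⟨n, x, rfl⟩ := lift x
    obtain ⟨m, rfl⟩ := w_surjective hinv w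
    obtain ⟨m', rfl⟩ := w_surjective hinv w'
    simp only [Category.assoc, hιΦ] at h
    have h' : (x ≫ m.μ ≫ Sigma.ι (fun _ => E.total) (m⁻¹ * n)) ≫ q =
        (x ≫ m'.μ ≫ Sigma.ι (fun _ => E.total) (m'⁻¹ * n)) ≫ q := by
      simpa only [Category.assoc] using h
    -- Equality in P means that m⁻¹n and m'⁻¹n differ by an element of T, so m and m' have the same
    -- image in W.
    obtain ⟨t, ht⟩ := hq.exists_act_eq h'
    simp only [Category.assoc, sigmaι_diagonalAction] at ht
    rw [← Category.assoc, ← Category.assoc, ← Category.assoc] at ht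
    have := congrArg MumfordGroup.w (eq_of_comp_sigmaι_eq ht)
    simpa only [mul_w, inv_w, incl_w, inv_one, one_mul, mul_left_inj, inv_inj] using this

omit [ConnectedSpace Z] hE hinv hq in
/-- The quotient map `E × N ⟶ F` factors as `(e, n) ↦ e n` followed by `e ↦ [(e, 1)]`. -/
theorem sigmaι_comp_eq {F : Scheme.{u}} {r : P ⟶ F} (hr : IsPrincipalBundle Φ r)
    (n : MumfordGroup ρ σ E) : Sigma.ι (fun _ => E.total) n ≫ q ≫ r =
      n.μ ≫ Sigma.ι (fun _ : MumfordGroup ρ σ E => E.total) 1 ≫ q ≫ r := by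
  conv_lhs => rw [← hr.act_comp n.w, ← Category.assoc q, ← hΦ, Category.assoc, sigmaι_diagonalAction_assoc,
    MonoidHom.id_apply, inv_mul_cancel]
  rfl

omit [ConnectedSpace Z] hE in
-- The map is étale, and surjective because the quotient map E × N → F factors through it. For
-- injectivity on points, if (x, 1) and (y, 1) agree in F, some n and t satisfy (xnt, t⁻¹n⁻¹) = (y,
-- 1). Then nt = 1 and x = y.
theorem isIso_sigmaι_comp {F : Scheme.{u}} {r : P ⟶ F} (hr : IsPrincipalBundle Φ r) :
    IsIso (Sigma.ι (fun _ : MumfordGroup ρ σ E => E.total) 1 ≫ q ≫ r) := by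
  have := hq.etale
  have := hq.surjective
  have := hr.etale
  have := hr.surjective
  have hfac : Sigma.desc (fun n : MumfordGroup ρ σ E => n.μ) ≫ Sigma.ι (fun _ : MumfordGroup ρ σ E => E.total) 1 ≫ q ≫ r =
      q ≫ r := by
    apply Sigma.hom_ext
    intro n
    rw [Sigma.ι_desc_assoc, sigmaι_comp_eq hΦ hr n]
  have : Surjective (Sigma.desc (fun n : MumfordGroup ρ σ E => n.μ) ≫
      Sigma.ι (fun _ : MumfordGroup ρ σ E => E.total) 1 ≫ q ≫ r) := hfac.symm ▸ inferInstance
  have := Surjective.of_comp (Sigma.desc fun n : MumfordGroup ρ σ E => n.μ)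
    (Sigma.ι (fun _ : MumfordGroup ρ σ E => E.total) 1 ≫ q ≫ r)
  refine isIso_of_etale_of_injective_points _ fun S _ _ x y hxy => ?_
  obtain ⟨w, hw⟩ := hr.exists_act_eq (x := x ≫ Sigma.ι (fun _ => E.total) 1 ≫ q)
    (y := y ≫ Sigma.ι (fun _ => E.total) 1 ≫ q) (by simpa only [Category.assoc] using hxy)
  obtain ⟨n, rfl⟩ := w_surjective hinv w
  rw [Category.assoc, Category.assoc, ← hΦ, sigmaι_diagonalAction_assoc, MonoidHom.id_apply,
    mul_one] at hw
  obtain ⟨t, ht⟩ := hq.exists_act_eq (x := x ≫ n.μ ≫ Sigma.ι (fun _ => E.total) n⁻¹)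
    (y := y ≫ Sigma.ι (fun _ => E.total) 1) (by
      rw [Category.assoc, Category.assoc, Category.assoc]
      exact hw)
  simp only [Category.assoc, sigmaι_diagonalAction] at ht
  rw [← Category.assoc, ← Category.assoc] at ht
  have hn := eq_of_comp_sigmaι_eq ht
  have hn' : n * incl ρ σ E t = 1 := inv_eq_one.mp ((mul_inv_rev _ _).trans hn)
  rw [hn, cancel_mono, Category.assoc, ← μ_incl (ρ := ρ) (σ := σ), ← μ_mul, hn', μ_one,
    Category.comp_id] at ht
  exact ht

end ContractedProduct

end MumfordGroup

/-! ### Transport along E ≅ F and the main theorem. -/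

theorem IsPrincipalBundle.of_iso {G : Type u} [Group G] {Y Y' B : Scheme.{u}}
    {ρ : RightAction G Y} {ρ' : RightAction G Y'} {f : Y ⟶ B} (hf : IsPrincipalBundle ρ f)
    (i : Y ≅ Y') (hi : ∀ g, ρ.act g ≫ i.hom = i.hom ≫ ρ'.act g) :
    IsPrincipalBundle ρ' (i.inv ≫ f) := by
  have := hf.etale
  have := hf.surjective
  have hi' (g : G) : ρ'.act g = i.inv ≫ ρ.act g ≫ i.hom := by rw [hi, i.inv_hom_id_assoc]
  refine .of_points (fun g => ?_) (fun S _ _ x y hxy => ?_) fun S _ _ x g h hgh => ?_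
  · simp [hi', hf.act_comp]
  · obtain ⟨g, hg⟩ := hf.exists_act_eq (x := x ≫ i.inv) (y := y ≫ i.inv) (by simpa using hxy)
    exact ⟨g, by rw [hi', ← Category.assoc, ← Category.assoc, hg]; simp⟩
  · refine hf.eq_of_act_eq (x := x ≫ i.inv) ?_
    rw [← cancel_mono i.hom]
    simpa [hi'] using hgh

/-- The transport of a right action along an isomorphism. -/
def RightAction.transport {G : Type u} [Group G] {Y Y' : Scheme.{u}} (ρ : RightAction G Y)
    (i : Y ≅ Y') : RightAction G Y' where
  act g := i.inv ≫ ρ.act g ≫ i.hom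
  act_one := by simp [ρ.act_one]
  act_mul g h := by simp [ρ.act_mul]

end MumfordBundle

theorem mainTheorem4 {T W : Type u} [CommGroup T] [Group W] [Finite W] (σ : W →* MulAut T)
    {X Z : Scheme.{u}} [ConnectedSpace Z] (π : Z ⟶ X)
    (ρ : MumfordBundle.RightAction W Z) (hπ : MumfordBundle.IsPrincipalBundle ρ π)
    (E : MumfordBundle.GScheme T Z) (hE : MumfordBundle.IsPrincipalBundle E.action E.proj)
    (hinv : ∀ w : W, Nonempty (E ≅ MumfordBundle.twistObj ρ σ w E)) :
    -- `E ⟶ Z ⟶ X` is a principal bundle under the Mumford group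
    MumfordBundle.IsPrincipalBundle (MumfordBundle.MumfordGroup.action ρ σ E) (E.proj ≫ π) ∧
    -- the contracted product `P` of `E` and the Mumford group `N` over `T` exists
    (∃ (P : Scheme.{u}) (q : (∐ fun _ : MumfordBundle.MumfordGroup ρ σ E => E.total) ⟶ P),
      MumfordBundle.IsPrincipalBundle
        (MumfordBundle.diagonalAction (MumfordBundle.MumfordGroup.incl ρ σ E) E.action) q) ∧
    ∀ (P : Scheme.{u}) (q : (∐ fun _ : MumfordBundle.MumfordGroup ρ σ E => E.total) ⟶ P),
      MumfordBundle.IsPrincipalBundle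
        (MumfordBundle.diagonalAction (MumfordBundle.MumfordGroup.incl ρ σ E) E.action) q →
      -- it carries the canonical linearisation
      (∃! Φ : MumfordBundle.RightAction W P, MumfordBundle.IsLinearisation ρ σ E q Φ) ∧
      ∀ Φ : MumfordBundle.RightAction W P, MumfordBundle.IsLinearisation ρ σ E q Φ →
        -- the quotient `F` of `P` by `W` exists
        (∃ (F : Scheme.{u}) (r : P ⟶ F), MumfordBundle.IsPrincipalBundle Φ r) ∧
        ∀ (F : Scheme.{u}) (r : P ⟶ F), MumfordBundle.IsPrincipalBundle Φ r →
          -- `F` is a principal `N`-bundle on `X`, for the action and projection induced by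
          -- `(e, n) · m = (e, n m)` and `(e, n) ↦ π (p e)`
          ∃ (R : MumfordBundle.RightAction (MumfordBundle.MumfordGroup ρ σ E) F) (f : F ⟶ X),
            (∀ m : MumfordBundle.MumfordGroup ρ σ E,
              (MumfordBundle.mulRightAction (MumfordBundle.MumfordGroup ρ σ E) E.total).act m ≫
                q ≫ r = q ≫ r ≫ R.act m) ∧
            q ≫ r ≫ f = Limits.Sigma.desc (fun _ => E.proj ≫ π) ∧
            MumfordBundle.IsPrincipalBundle R f ∧
            -- and `e ↦ [(e, 1)]` is an isomorphism of principal `N`-bundles on `X`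
            ∃ i : E.total ≅ F,
              i.hom = Sigma.ι (fun _ : MumfordBundle.MumfordGroup ρ σ E => E.total) 1 ≫ q ≫ r ∧
              i.hom ≫ f = E.proj ≫ π ∧
              ∀ n : MumfordBundle.MumfordGroup ρ σ E,
                (MumfordBundle.MumfordGroup.action ρ σ E).act n ≫ i.hom = i.hom ≫ R.act n := by
  refine ⟨MumfordBundle.MumfordGroup.isPrincipalBundle hE hπ hinv,
    ⟨_, _, MumfordBundle.MumfordGroup.isPrincipalBundle_sigmaDesc_μ hE hinv⟩, fun P q hq =>
    ⟨MumfordBundle.MumfordGroup.existsUnique_isLinearisation hE hinv hq, fun Φ hΦ =>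
      ⟨MumfordBundle.MumfordGroup.exists_isPrincipalBundle_of_isLinearisation hE hinv hq hΦ,
        fun F r hr => ?_⟩⟩⟩
  have := MumfordBundle.MumfordGroup.isIso_sigmaι_comp hinv hq hΦ hr
  let i := asIso
    (Sigma.ι (fun _ : MumfordBundle.MumfordGroup ρ σ E => E.total) 1 ≫ q ≫ r)
  have hi (n : MumfordBundle.MumfordGroup ρ σ E) :
      Sigma.ι (fun _ => E.total) n ≫ q ≫ r = n.μ ≫ i.hom :=
    MumfordBundle.MumfordGroup.sigmaι_comp_eq hΦ hr n
  have hequiv (n : MumfordBundle.MumfordGroup ρ σ E) :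
      (MumfordBundle.MumfordGroup.action ρ σ E).act n ≫ i.hom =
        i.hom ≫ ((MumfordBundle.MumfordGroup.action ρ σ E).transport i).act n :=
    (i.hom_inv_id_assoc _).symm
  -- The class of (e, n) in F is i(en). So right multiplication by m becomes the action of m on E,
  -- and the projection becomes π ∘ p because π is W-invariant.
  refine ⟨(MumfordBundle.MumfordGroup.action ρ σ E).transport i, i.inv ≫ E.proj ≫ π,
    fun m => ?_, ?_,
    (MumfordBundle.MumfordGroup.isPrincipalBundle hE hπ hinv).of_iso i hequiv,
    i, rfl, i.hom_inv_id_assoc _, hequiv⟩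
  · apply Sigma.hom_ext
    intro n
    rw [← Category.assoc, MumfordBundle.sigmaι_mulRightAction, hi, ← Category.assoc q, ← Category.assoc, hi,
      Category.assoc, ← hequiv, MumfordBundle.MumfordGroup.μ_mul, Category.assoc]
    rfl
  · apply Sigma.hom_ext
    intro n
    rw [Sigma.ι_desc, ← Category.assoc q, ← Category.assoc, hi, Category.assoc,
      i.hom_inv_id_assoc, ← Category.assoc, MumfordBundle.MumfordGroup.μ_proj, Category.assoc, hπ.act_comp]
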